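/- **Theorem (converse for guessing).** Let $\log=\log_2$. A *finite-state (hidden Markov) source* with $s$ states over an alphabet of size $\alpha$ consists of a finite alphabet $\mathcal X$ with $|\mathcal X|=\alpha$, a finite state set $\mathcal Z$ with $|\mathcal Z|=s$, a fixed initial state $z_1\in\mathcal Z$ and conditional probabilities $P(x,z'|z)\ge 0$ with $\sum_{x,z'}P(x,z'|z)=1$ for each $z\in\mathcal Z$; for every $n$ it defines the distribution $$P(\boldsymbol x)=\sum_{(z_2,\dots,z_{n+1})\in\mathcal Z^n}\ \prod_{i=1}^nP(x_i,z_{i+1}|z_i),\qquad \boldsymbol x=(x_1,\dots,x_n)\in\mathcal X^n .$$ A *guessing function* is a bijection $G:\mathcal X^n\to\{1,\dots,\alpha^n\}$. Let $c(\boldsymbol x)$ be the number of phrases in the incremental (LZ78) parsing of $\boldsymbol x$, in which the word is read from left to right and each new phrase is the shortest string that has not been obtained before as a phrase; a nonempty incomplete remainder at the end of the word is counted as a phrase. We use $0\log 0=0$. There are real numbers $\Delta_n=\Delta_n(s,\alpha)$, depending only on $s$, $\alpha$ and $n$, with $\Delta_n\to0$ as $n\to\infty$ for all fixed $s$ and $\alpha$,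 such that for every finite-state source with $s$ states over an alphabet of size $\alpha$, every $n$, every guessing function $G:\mathcal X^n\to\{1,\dots,\alpha^n\}$ and every real $\rho>0$, $$\mathbf E\{G^\rho(\boldsymbol X)\}\ \ge\ 2^{-\rho n\Delta_n}\,\mathbf E\big[2^{\rho\,c(\boldsymbol X)\log c(\boldsymbol X)}\big],$$ where $\boldsymbol X=(X_1,\dots,X_n)$ is drawn from the source. In particular, for each fixed $\rho>0$ the inequality holds with the factor $2^{-n\Delta'_n}$, where $\Delta_n'=\rho\Delta_n\to0$. -/

import Mathlib

/-- A finite-state (hidden Markov) source with alphabet `X` and state set `Z`: a fixed initial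
state and the conditional probabilities `prob z x z'` of emitting the letter `x` and moving to
the state `z'`, given the current state `z`. -/
structure FiniteStateSource (X Z : Type*) [Fintype X] [Fintype Z] where
  init : Z
  prob : Z → X → Z → ℝ
  prob_nonneg : ∀ z x z', 0 ≤ prob z x z'
  prob_sum : ∀ z, ∑ x, ∑ z', prob z x z' = 1

namespace FiniteStateSource

variable {X Z : Type*} [Fintype X] [Fintype Z]

/-- The full state sequence `z₁, z₂, …, zₙ₊₁`, where `z₁` is the initial state and
`z = (z₂, …, zₙ₊₁)`. -/
def path (P : FiniteStateSource X Z) {n : ℕ} (z : Fin n → Z) : Fin (n + 1) → Z :=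
  Fin.cons P.init z

/-- The probability of the word `x = (x₁, …, xₙ)`: the sum over all state sequences starting at
the initial state of `∏ i, P(xᵢ, zᵢ₊₁ | zᵢ)`. -/
noncomputable def wordProb (P : FiniteStateSource X Z) {n : ℕ} (x : Fin n → X) : ℝ :=
  ∑ z : Fin n → Z, ∏ i : Fin n, P.prob (P.path z i.castSucc) (x i) (P.path z i.succ)

/-- The expectation of `f(X₁, …, Xₙ)` when `(X₁, …, Xₙ)` is drawn from the source. -/
noncomputable def expect (P : FiniteStateSource X Z) {n : ℕ} (f : (Fin n → X) → ℝ) : ℝ :=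
  ∑ x : Fin n → X, P.wordProb x * f x

end FiniteStateSource

/-- A (deterministic) guessing function on words of length `n`: a bijection from `Xⁿ` onto
`{1, …, |X|ⁿ}`; `G x` is the position of `x` in the guessing list. -/
def IsGuessingFunction {X : Type*} [Fintype X] {n : ℕ} (G : (Fin n → X) → ℕ) : Prop :=
  Set.BijOn G Set.univ (Set.Icc 1 (Fintype.card X ^ n))

/-- One run of incremental parsing. `phrases` are the phrases found so far, `cur` is the part of
the current phrase read so far, and the last argument is what remains to be read. The current
phrase is closed as soon as it differs from all earlier phrases. When the input ends inside a
phrase, the nonempty remainder is kept as a last, incomplete, phrase. -/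
def lzParseAux {X : Type*} [DecidableEq X] :
    List (List X) → List X → List X → List (List X)
  | phrases, cur, [] => if cur = [] then phrases else phrases ++ [cur]
  | phrases, cur, a :: rest =>
    if cur ++ [a] ∈ phrases then lzParseAux phrases (cur ++ [a]) rest
    else lzParseAux (phrases ++ [cur ++ [a]]) [] rest

/-- The list of phrases of the Lempel-Ziv (1978) incremental parsing of a word. -/
def lzParse {X : Type*} [DecidableEq X] (w : List X) : List (List X) :=
  lzParseAux [] [] w

/-- The number `c(x)` of phrases in the incremental parsing of `x`. -/
def lzCount {X : Type*} [DecidableEq X] {n : ℕ} (x : Fin n → X) : ℕ :=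
  (lzParse (List.ofFn x)).length

/-! Cut x at its c = c(x) phrases. Given the states at the cuts, permuting phrases that share their
length and both end states, with the last phrase fixed, leaves the probability of that path
unchanged. Different permutations give different words, because all phrases but the last are
distinct. Weighing labels by a product distribution shows that there are at least c^c / D such
permutations (`factorial_mul_prod_le_card_perm`, `pow_self_le_card_blockPerms`), with D = 2^{o(n)}
since c = o(n) (`length_lzParse_mul_le`). Over these words the values 1/G sum to at most H, a bound
for a harmonic number that is linear in n, so by Jensen the mean of G^ρ over them is at least (c^c /
(D H))^ρ (`sum_pathProb_le`). Summing over phrase lengths and states costs a factor (n + 1) D.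

That factor is not raised to the power ρ, so this bound is poor for small ρ. There the same
permutations give Ziv's inequality P(x) c^c ≤ D² and also c^c ≤ D α^n. Jensen for G / c^c under the
weights P(x) (c^c)^ρ then loses only (D² H (D α^n)^ρ)^ρ (`sum_listProb_mul_le_of_ziv`). With 2^{nv}
= D H, switching between the two bounds at ρ = √v gives a loss independent of ρ
(`sum_listProb_mul_le`). -/

/-! ### Jensen's inequality and counting permutations -/

/-- If the weighted mean of `1 / g` is at most `b`, then the weighted mean of `g ^ ρ` is at least
`b ^ (-ρ)`. -/
theorem sum_le_rpow_mul_sum_mul_rpow {ι : Type*} (t : Finset ι) (w g : ι → ℝ) {b ρ : ℝ}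
    (hw : ∀ i ∈ t, 0 ≤ w i) (hg : ∀ i ∈ t, 0 < g i) (hb : 0 < b) (hρ : 0 < ρ)
    (h : ∑ i ∈ t, w i / g i ≤ b * ∑ i ∈ t, w i) :
    ∑ i ∈ t, w i ≤ b ^ ρ * ∑ i ∈ t, w i * g i ^ ρ := by
  have key : ∀ i ∈ t, w i + ρ * (w i - w i / g i / b) ≤ b ^ ρ * (w i * g i ^ ρ) := by
    intro i hi
    have hgi := hg i hi
    have hbg : 0 < b * g i := mul_pos hb hgi
    -- The tangent at u = 1 of the convex function u ↦ u^{-ρ}, with u = 1 / (b g). It is linear in 1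
    -- / g, so it can be summed against `h`.
    have h1 : 1 + ρ * (1 - (b * g i)⁻¹) ≤ (b * g i) ^ ρ := by
      rw [Real.rpow_def_of_pos hbg]
      have h2 := Real.add_one_le_exp (Real.log (b * g i) * ρ)
      have h3 := Real.one_sub_inv_le_log_of_pos hbg
      nlinarith
    have h4 := mul_le_mul_of_nonneg_left h1 (hw i hi)
    rw [Real.mul_rpow hb.le hgi.le] at h4
    calc _ = w i * (1 + ρ * (1 - (b * g i)⁻¹)) := by field_simp
      _ ≤ _ := h4
      _ = _ := by ring
  have h5 := Finset.sum_le_sum key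
  rw [← Finset.mul_sum, Finset.sum_add_distrib, ← Finset.mul_sum, Finset.sum_sub_distrib,
    ← Finset.sum_div] at h5
  have h6 : (∑ i ∈ t, w i / g i) / b ≤ ∑ i ∈ t, w i := by
    rw [div_le_iff₀ hb]; linarith
  nlinarith

/-- The number of permutations that preserve a labelling is at least `c!` times the probability of
the labelling under any product (sub)distribution. -/
theorem factorial_mul_prod_le_card_perm {c : ℕ} {Λ : Type*} [DecidableEq Λ] (l : Fin c → Λ)
    (t : Finset Λ) (hl : ∀ j, l j ∈ t) (q : Λ → ℝ) (hq : ∀ a, 0 ≤ q a) (hs : ∑ a ∈ t, q a ≤ 1) :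
    (c.factorial : ℝ) * ∏ j, q (l j) ≤
      (Finset.univ.filter fun π : Equiv.Perm (Fin c) => ∀ j, l (π j) = l j).card := by
  set S := Finset.univ.filter fun π : Equiv.Perm (Fin c) => ∀ j, l (π j) = l j with hS
  have h1 : (c.factorial : ℝ) * ∏ j, q (l j) =
      ∑ π : Equiv.Perm (Fin c), ∏ j, q (l (π j)) := by
    have : ∀ π : Equiv.Perm (Fin c), ∏ j, q (l (π j)) = ∏ j, q (l j) := fun π =>
      Equiv.prod_comp π fun j => q (l j)
    simp [this, Finset.card_univ, Fintype.card_perm]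
  have h2 : ∑ π : Equiv.Perm (Fin c), ∏ j, q (l (π j)) =
      ∑ m ∈ Fintype.piFinset fun _ : Fin c => t,
        ∑ π ∈ Finset.univ.filter (fun π : Equiv.Perm (Fin c) => (fun j => l (π j)) = m),
          ∏ j, q (l (π j)) := by
    rw [Finset.sum_fiberwise_of_maps_to]
    intro π _
    exact Fintype.mem_piFinset.2 fun j => hl _
  have h3 : ∀ m ∈ Fintype.piFinset fun _ : Fin c => t,
      ∑ π ∈ Finset.univ.filter (fun π : Equiv.Perm (Fin c) => (fun j => l (π j)) = m),
          ∏ j, q (l (π j)) ≤ S.card * ∏ j, q (m j) := by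
    intro m _
    have h4 : ∑ π ∈ Finset.univ.filter (fun π : Equiv.Perm (Fin c) => (fun j => l (π j)) = m),
          ∏ j, q (l (π j)) =
        ∑ π ∈ Finset.univ.filter (fun π : Equiv.Perm (Fin c) => (fun j => l (π j)) = m),
          ∏ j, q (m j) := by
      refine Finset.sum_congr rfl fun π hπ => ?_
      have := (Finset.mem_filter.1 hπ).2
      subst this; rfl
    rw [h4, Finset.sum_const, nsmul_eq_mul]
    refine mul_le_mul_of_nonneg_right ?_ (Finset.prod_nonneg fun j _ => hq _)
    norm_cast
    rcases (Finset.univ.filter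
      (fun π : Equiv.Perm (Fin c) => (fun j => l (π j)) = m)).eq_empty_or_nonempty with h | ⟨σ, hσ⟩
    · rw [h]; simp
    -- A nonempty fibre is a coset of the stabilizer `S` of the labelling.
    · refine Finset.card_le_card_of_injOn (fun π => π * σ⁻¹) ?_ ?_
      · intro π hπ
        have h5 := (Finset.mem_filter.1 hπ).2
        have h6 := (Finset.mem_filter.1 hσ).2
        simp only [hS, Finset.coe_filter, Finset.mem_univ, true_and, Set.mem_ofPred_eq]
        intro j
        have h7 := congrFun (h5.trans h6.symm) (σ⁻¹ j)
        simpa using h7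
      · intro a _ b _ hab
        exact mul_right_cancel hab
  rw [h1, h2]
  refine (Finset.sum_le_sum h3).trans ?_
  -- The sum over all label sequences factors as (∑ q)^c.
  rw [← Finset.mul_sum, ← Finset.prod_univ_sum (fun _ : Fin c => t) (fun _ a => q a)]
  have h8 : ∏ _j : Fin c, ∑ a ∈ t, q a ≤ 1 :=
    Finset.prod_le_one (fun _ _ => Finset.sum_nonneg fun a _ => hq a) fun _ _ => hs
  exact mul_le_of_le_one_right (Nat.cast_nonneg _) h8

/-! ### Geometric weights and the number of length sequences -/

/-- Geometric weights on block lengths, with parameter `η`. -/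
noncomputable def lengthWeight (η : ℝ) (k : ℕ) : ℝ := η / (1 + η) * ((1 + η)⁻¹) ^ k

theorem lengthWeight_pos {η : ℝ} (hη : 0 < η) (k : ℕ) : 0 < lengthWeight η k := by
  unfold lengthWeight; positivity

theorem sum_lengthWeight_le_one {η : ℝ} (hη : 0 < η) (m : ℕ) :
    ∑ k ∈ Finset.range m, lengthWeight η k ≤ 1 := by
  unfold lengthWeight
  rw [← Finset.mul_sum]
  have h1 : (1 + η)⁻¹ < 1 := inv_lt_one_of_one_lt₀ (by linarith)
  have h0 : 0 < (1 + η)⁻¹ := by positivity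
  have h2 : ∑ k ∈ Finset.range m, ((1 + η)⁻¹) ^ k ≤ (1 - (1 + η)⁻¹)⁻¹ := by
    rw [← tsum_geometric_of_lt_one h0.le h1]
    exact (summable_geometric_of_lt_one h0.le h1).sum_le_tsum _ fun _ _ => by positivity
  calc _ ≤ η / (1 + η) * (1 - (1 + η)⁻¹)⁻¹ := by gcongr
    _ = 1 := by
      have : 1 - (1 + η)⁻¹ = η / (1 + η) := by field_simp; ring
      rw [this, mul_inv_cancel₀]; positivity

/-- The reason for geometric weights: the product depends on the lengths only through their number
and their total. -/
theorem prod_lengthWeight {c : ℕ} (η : ℝ) (l : Fin c → ℕ) :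
    ∏ j, lengthWeight η (l j) = (η / (1 + η)) ^ c * ((1 + η)⁻¹) ^ (∑ j, l j) := by
  simp only [lengthWeight, Finset.prod_mul_distrib, Finset.prod_pow_eq_pow_sum, Finset.prod_const,
    Finset.card_univ, Fintype.card_fin]

/-- The number of lists of `c` natural numbers with sum `n`. -/
theorem card_le_of_length_of_sum {n c : ℕ} {η : ℝ} (hη : 0 < η) (A : Finset (List ℕ))
    (hlen : ∀ L ∈ A, L.length = c) (hsum : ∀ L ∈ A, L.sum = n) :
    (A.card : ℝ) ≤ ((1 + η) / η) ^ c * (1 + η) ^ n := by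
  have hinj : Set.InjOn (fun (L : List ℕ) (j : Fin c) => L.getD j 0) A := by
    intro L hL L' hL' h
    refine List.ext_getElem ((hlen L hL).trans (hlen L' hL').symm) fun i h1 h2 => ?_
    have := congrFun h ⟨i, (hlen L hL) ▸ h1⟩
    simpa [h1, h2] using this
  have hof : ∀ L ∈ A, List.ofFn (fun j : Fin c => L.getD j 0) = L := by
    intro L hL
    refine List.ext_getElem (by simp [hlen L hL]) fun i h1 h2 => ?_
    simp [h2]
  have hs : ∀ L ∈ A, ∑ j : Fin c, L.getD j 0 = n := by
    intro L hL
    rw [← List.sum_ofFn, hof L hL, hsum L hL]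
  -- All lists in `A` have the same weight and the weights sum to at most 1, so the reciprocal of
  -- one weight bounds their number.
  have h1 : ∑ L ∈ A, ∏ j : Fin c, lengthWeight η (L.getD j 0) ≤ 1 := by
    calc ∑ L ∈ A, ∏ j : Fin c, lengthWeight η (L.getD j 0)
        = ∑ m ∈ A.image (fun (L : List ℕ) (j : Fin c) => L.getD j 0),
            ∏ j, lengthWeight η (m j) := (Finset.sum_image (f := fun m : Fin c → ℕ =>
              ∏ j, lengthWeight η (m j)) hinj).symm
      _ ≤ ∑ m ∈ Fintype.piFinset fun _ : Fin c => Finset.range (n + 1),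
            ∏ j, lengthWeight η (m j) := by
          refine Finset.sum_le_sum_of_subset_of_nonneg ?_ fun _ _ _ =>
            Finset.prod_nonneg fun _ _ => (lengthWeight_pos hη _).le
          intro m hm
          obtain ⟨L, hL, rfl⟩ := Finset.mem_image.1 hm
          refine Fintype.mem_piFinset.2 fun j => Finset.mem_range.2 (Nat.lt_succ_of_le ?_)
          rw [← hs L hL]
          exact Finset.single_le_sum (f := fun j : Fin c => L.getD j 0)
            (fun _ _ => Nat.zero_le _) (Finset.mem_univ j)
      _ ≤ 1 := by
          rw [← Finset.prod_univ_sum (fun _ : Fin c => Finset.range (n + 1))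
            (fun _ a => lengthWeight η a)]
          exact Finset.prod_le_one
            (fun _ _ => Finset.sum_nonneg fun a _ => (lengthWeight_pos hη a).le)
            fun _ _ => sum_lengthWeight_le_one hη _
  have h2 : ∑ L ∈ A, ∏ j : Fin c, lengthWeight η (L.getD j 0) =
      A.card * ((η / (1 + η)) ^ c * ((1 + η)⁻¹) ^ n) := by
    rw [← nsmul_eq_mul, ← Finset.sum_const]
    refine Finset.sum_congr rfl fun L hL => ?_
    rw [prod_lengthWeight, hs L hL]
  rw [h2] at h1
  have h3 : (η / (1 + η)) ^ c * ((1 + η)⁻¹) ^ n = (((1 + η) / η) ^ c * (1 + η) ^ n)⁻¹ := by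
    rw [mul_inv, ← inv_pow, ← inv_pow, inv_div]
  rw [h3, ← div_eq_mul_inv, div_le_one (by positivity)] at h1
  exact h1

/-! ### Words as lists and their concatenation -/

section Words

variable (X : Type*) [Fintype X]

/-- The words of length `n`, as lists. -/
def listWords (n : ℕ) : Finset (List X) :=
  Finset.univ.map ⟨fun x : Fin n → X => List.ofFn x, List.ofFn_injective⟩

variable {X}

theorem mem_listWords {n : ℕ} {w : List X} : w ∈ listWords X n ↔ w.length = n := by
  simp only [listWords, Finset.mem_map, Finset.mem_univ, true_and, Function.Embedding.coeFn_mk]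
  constructor
  · rintro ⟨x, rfl⟩; simp
  · rintro rfl; exact ⟨w.get, List.ofFn_get w⟩

theorem card_listWords (n : ℕ) : (listWords X n).card = Fintype.card X ^ n := by
  simp [listWords]

theorem sum_listWords {n : ℕ} (f : List X → ℝ) :
    ∑ w ∈ listWords X n, f w = ∑ x : Fin n → X, f (List.ofFn x) := by
  simp [listWords]

end Words

/-- Known block lengths determine where to cut the concatenation. -/
theorem ofFn_flatten_injective {X : Type*} {c : ℕ} {y y' : Fin c → List X}
    (hlen : ∀ j, (y j).length = (y' j).length)
    (h : (List.ofFn y).flatten = (List.ofFn y').flatten) : y = y' := by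
  refine List.ofFn_injective (List.eq_iff_flatten_eq.2 ⟨h, ?_⟩)
  rw [List.map_ofFn, List.map_ofFn]
  congr 1; funext j; exact hlen j

theorem length_ofFn_flatten {X : Type*} {c : ℕ} (y : Fin c → List X) :
    (List.ofFn y).flatten.length = ∑ j, (y j).length := by
  rw [List.length_flatten, List.map_ofFn, List.sum_ofFn]; rfl

/-! ### Incremental parsing and the number of phrases -/

section Parsing

variable {X : Type*} [DecidableEq X]

theorem flatten_lzParseAux (w : List X) : ∀ (phrases : List (List X)) (cur : List X),
    (lzParseAux phrases cur w).flatten = phrases.flatten ++ cur ++ w := by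
  induction w with
  | nil => intro p cur; unfold lzParseAux; split_ifs with h <;> simp [h]
  | cons a w ih => intro p cur; unfold lzParseAux; split_ifs with h <;> simp [ih]

/-- The closing test keeps every completed phrase new; only the incomplete remainder can repeat an
earlier one. -/
theorem nodup_dropLast_lzParseAux (w : List X) : ∀ (phrases : List (List X)) (cur : List X),
    phrases.Nodup → (lzParseAux phrases cur w).dropLast.Nodup := by
  induction w with
  | nil =>
    intro p cur hp; unfold lzParseAux
    split_ifs with h
    · exact hp.sublist (List.dropLast_sublist _)
    · simpa using hp
  | cons a w ih =>
    intro p cur hp; unfold lzParseAux; split_ifs with h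
    · exact ih _ _ hp
    · refine ih _ _ (hp.append (List.nodup_singleton _) ?_)
      simpa using h

theorem ne_nil_of_mem_lzParseAux (w : List X) : ∀ (phrases : List (List X)) (cur : List X),
    (∀ p ∈ phrases, p ≠ []) → ∀ p ∈ lzParseAux phrases cur w, p ≠ [] := by
  induction w with
  | nil =>
    intro p cur hp; unfold lzParseAux
    split_ifs with h
    · exact hp
    · intro q hq
      rcases List.mem_append.1 hq with hq | hq
      · exact hp q hq
      · rw [List.mem_singleton.1 hq]; exact h
  | cons a w ih =>
    intro p cur hp; unfold lzParseAux; split_ifs with h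
    · exact ih _ _ hp
    · refine ih _ _ fun q hq => ?_
      rcases List.mem_append.1 hq with hq | hq
      · exact hp q hq
      · rw [List.mem_singleton.1 hq]; simp

theorem flatten_lzParse (w : List X) : (lzParse w).flatten = w := by
  simp [lzParse, flatten_lzParseAux]

theorem nodup_dropLast_lzParse (w : List X) : (lzParse w).dropLast.Nodup :=
  nodup_dropLast_lzParseAux w _ _ List.nodup_nil

theorem sum_map_length_lzParse (w : List X) : ((lzParse w).map List.length).sum = w.length := by
  rw [← List.length_flatten, flatten_lzParse]

theorem length_lzParse_le (w : List X) : (lzParse w).length ≤ w.length := by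
  have := List.length_le_sum_of_one_le ((lzParse w).map List.length) (by
    intro i hi
    obtain ⟨p, hp, rfl⟩ := List.mem_map.1 hi
    exact List.length_pos_iff.2
      (ne_nil_of_mem_lzParseAux w [] [] (by simp) p hp))
  rw [sum_map_length_lzParse] at this
  simpa using this

theorem card_lists_length_le [Fintype X] (k : ℕ) (A : Finset (List X))
    (hA : ∀ w ∈ A, w.length ≤ k) : A.card ≤ (Fintype.card X + 1) ^ k := by
  calc A.card ≤ ((Finset.range (k + 1)).biUnion fun i => listWords X i).card := by
        refine Finset.card_le_card fun w hw => ?_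
        simp only [Finset.mem_biUnion, Finset.mem_range, mem_listWords]
        exact ⟨_, Nat.lt_succ_of_le (hA w hw), rfl⟩
    _ ≤ ∑ i ∈ Finset.range (k + 1), Fintype.card X ^ i := by
        refine Finset.card_biUnion_le.trans_eq (Finset.sum_congr rfl fun i _ => card_listWords i)
    _ ≤ _ := by
        -- Termwise comparison with the binomial expansion, whose coefficients are at least 1.
        rw [add_pow]
        refine Finset.sum_le_sum fun i hi => ?_
        simp only [one_pow, mul_one, Nat.cast_id]
        exact Nat.le_mul_of_pos_right _
          (Nat.choose_pos (Nat.lt_succ_iff.1 (Finset.mem_range.1 hi)))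

/-- Few phrases are short and the long ones cannot be many. -/
theorem length_lzParse_mul_le [Fintype X] (w : List X) (k : ℕ) :
    (lzParse w).length * (k + 1) ≤ (1 + (Fintype.card X + 1) ^ k) * (k + 1) + w.length := by
  set p := (lzParse w).dropLast with hp
  have hnd : p.Nodup := nodup_dropLast_lzParse w
  have hlen : (lzParse w).length ≤ p.length + 1 := by simp [hp]; omega
  have hsum : (p.map List.length).sum ≤ w.length := by
    rw [← sum_map_length_lzParse]
    exact ((List.dropLast_sublist _).map _).sum_le_sum fun _ _ => Nat.zero_le _
  have hsum' : ∑ q ∈ p.toFinset, q.length = (p.map List.length).sum := List.sum_toFinset _ hnd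
  have hcard : p.toFinset.card = p.length := List.toFinset_card_of_nodup hnd
  have hshort := card_lists_length_le k (p.toFinset.filter fun q => q.length ≤ k)
    fun q hq => (Finset.mem_filter.1 hq).2
  have hlong : (p.toFinset.filter fun q => ¬ q.length ≤ k).card * (k + 1) ≤ w.length := by
    refine le_trans ?_ (hsum'.le.trans hsum)
    calc _ = ∑ q ∈ p.toFinset.filter (fun q => ¬ q.length ≤ k), (k + 1) := by simp
      _ ≤ ∑ q ∈ p.toFinset.filter (fun q => ¬ q.length ≤ k), q.length :=
        Finset.sum_le_sum fun q hq => by have := (Finset.mem_filter.1 hq).2; omega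
      _ ≤ _ := Finset.sum_le_sum_of_subset (Finset.filter_subset _ _)
  have hsplit := Finset.card_filter_add_card_filter_not (s := p.toFinset) fun q => q.length ≤ k
  have : (lzParse w).length ≤ 1 + (Fintype.card X + 1) ^ k +
    (p.toFinset.filter fun q => ¬ q.length ≤ k).card := by omega
  nlinarith

end Parsing

/-! ### Transition matrices and label-preserving permutations of blocks -/

namespace FiniteStateSource

variable {X Z : Type*} [Fintype X] [Fintype Z]

/-- The matrix of the probabilities of emitting the word `w` while moving between given states. -/
noncomputable def trans [DecidableEq Z] (P : FiniteStateSource X Z) (w : List X) : Matrix Z Z ℝ :=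
  (w.map fun a => Matrix.of fun z z' => P.prob z a z').prod

/-- The probability of a word, given as a list. -/
noncomputable def listProb [DecidableEq Z] (P : FiniteStateSource X Z) (w : List X) : ℝ :=
  ∑ z, P.trans w P.init z

/-- The probability of the consecutive blocks `y` together with the states `z` at the block
boundaries. -/
noncomputable def pathProb [DecidableEq Z] (P : FiniteStateSource X Z) {c : ℕ} (z : Fin c → Z)
    (y : Fin c → List X) : ℝ :=
  ∏ j, P.trans (y j) (P.path z j.castSucc) (P.path z j.succ)

/-- The label of a block: whether it is the last one, its length, and the states at its two ends. -/
def blockLabel (P : FiniteStateSource X Z) {c : ℕ} (z : Fin c → Z) (l : Fin c → ℕ) (j : Fin c) :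
    Bool × ℕ × Z × Z :=
  (decide (j.val + 1 = c), l j, P.path z j.castSucc, P.path z j.succ)

/-- The permutations of the blocks that preserve the labels. -/
def blockPerms [DecidableEq Z] (P : FiniteStateSource X Z) {c : ℕ} (z : Fin c → Z)
    (l : Fin c → ℕ) : Finset (Equiv.Perm (Fin c)) :=
  Finset.univ.filter fun π => ∀ j, P.blockLabel z l (π j) = P.blockLabel z l j

variable [DecidableEq Z] (P : FiniteStateSource X Z)

/-- Expands a matrix product over paths. It serves both for single letters and for whole blocks. -/
theorem sum_prod_matrix_apply {c : ℕ} : ∀ (A : Fin c → Matrix Z Z ℝ) (i : Z),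
    ∑ k, (List.ofFn A).prod i k =
      ∑ z : Fin c → Z, ∏ j, A j ((Fin.cons i z : Fin (c + 1) → Z) j.castSucc)
        ((Fin.cons i z : Fin (c + 1) → Z) j.succ) := by
  induction c with
  | zero => intro A i; simp [Matrix.one_apply]
  | succ c ih =>
    intro A i
    rw [List.ofFn_succ, List.prod_cons]
    simp only [Matrix.mul_apply]
    rw [Finset.sum_comm]
    simp only [← Finset.mul_sum, ih]
    rw [← (Fin.consEquiv fun _ : Fin (c + 1) => Z).sum_comp, Fintype.sum_prod_type]
    refine Finset.sum_congr rfl fun k _ => ?_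
    rw [Finset.mul_sum]
    refine Finset.sum_congr rfl fun z _ => ?_
    rw [Fin.prod_univ_succ]
    rfl

theorem trans_nil : P.trans [] = 1 := rfl

theorem trans_cons (a : X) (w : List X) :
    P.trans (a :: w) = (Matrix.of fun z z' => P.prob z a z') * P.trans w := by
  simp [trans]

theorem trans_flatten (L : List (List X)) : P.trans L.flatten = (L.map P.trans).prod := by
  induction L with
  | nil => rfl
  | cons w L ih => simp [← ih, trans]

theorem trans_nonneg (w : List X) (z z' : Z) : 0 ≤ P.trans w z z' := by
  induction w generalizing z with
  | nil => rw [trans_nil, Matrix.one_apply]; split_ifs <;> norm_num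
  | cons a w ih =>
    rw [trans_cons, Matrix.mul_apply]
    exact Finset.sum_nonneg fun k _ => mul_nonneg (P.prob_nonneg _ _ _) (ih k)

theorem listProb_nonneg (w : List X) : 0 ≤ P.listProb w :=
  Finset.sum_nonneg fun _ _ => P.trans_nonneg _ _ _

theorem pathProb_nonneg {c : ℕ} (z : Fin c → Z) (y : Fin c → List X) : 0 ≤ P.pathProb z y :=
  Finset.prod_nonneg fun _ _ => P.trans_nonneg _ _ _

theorem wordProb_eq_listProb {n : ℕ} (x : Fin n → X) : P.wordProb x = P.listProb (List.ofFn x) := by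
  unfold wordProb listProb trans
  rw [List.map_ofFn, sum_prod_matrix_apply]
  rfl

theorem listProb_flatten {c : ℕ} (y : Fin c → List X) :
    P.listProb (List.ofFn y).flatten = ∑ z : Fin c → Z, P.pathProb z y := by
  unfold listProb
  rw [trans_flatten, List.map_ofFn, sum_prod_matrix_apply]
  rfl

theorem pathProb_le_listProb {c : ℕ} (z : Fin c → Z) (y : Fin c → List X) :
    P.pathProb z y ≤ P.listProb (List.ofFn y).flatten := by
  rw [listProb_flatten]
  exact Finset.single_le_sum (f := fun z => P.pathProb z y)
    (fun z _ => P.pathProb_nonneg z y) (Finset.mem_univ z)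

/-- The one-letter matrices add up to a row-stochastic matrix. The induction needs every starting
state, not only the initial one. -/
theorem sum_trans (n : ℕ) : ∀ z, ∑ x : Fin n → X, ∑ k, P.trans (List.ofFn x) z k = 1 := by
  induction n with
  | zero => intro z; simp [trans_nil, Matrix.one_apply]
  | succ n ih =>
    intro z
    rw [← (Fin.consEquiv fun _ : Fin (n + 1) => X).sum_comp, Fintype.sum_prod_type]
    have h : ∀ (a : X) (x : Fin n → X), ∑ k, P.trans
        (List.ofFn ((Fin.consEquiv fun _ : Fin (n + 1) => X) (a, x))) z k =
        ∑ k, P.prob z a k * ∑ k', P.trans (List.ofFn x) k k' := by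
      intro a x
      have : List.ofFn ((Fin.consEquiv fun _ : Fin (n + 1) => X) (a, x)) = a :: List.ofFn x := by
        simp [Fin.consEquiv]
      rw [this, trans_cons]
      simp only [Matrix.mul_apply, Finset.mul_sum, Matrix.of_apply]
      rw [Finset.sum_comm]
    simp only [h]
    rw [← P.prob_sum z]
    refine Finset.sum_congr rfl fun a _ => ?_
    rw [Finset.sum_comm]
    refine Finset.sum_congr rfl fun k _ => ?_
    rw [← Finset.mul_sum, ih, mul_one]

theorem sum_listProb (n : ℕ) : ∑ w ∈ listWords X n, P.listProb w = 1 := by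
  rw [sum_listWords]
  exact P.sum_trans n P.init

/-- The block moved to position j has the same end states there as at its original position, so the
factors are only reordered. -/
theorem pathProb_comp {c : ℕ} {z : Fin c → Z} {l : Fin c → ℕ} {π : Equiv.Perm (Fin c)}
    (hπ : π ∈ P.blockPerms z l) (y : Fin c → List X) :
    P.pathProb z (y ∘ π) = P.pathProb z y := by
  have h := (Finset.mem_filter.1 hπ).2
  unfold pathProb
  rw [← Equiv.prod_comp π fun j => P.trans (y j) (P.path z j.castSucc) (P.path z j.succ)]
  refine Finset.prod_congr rfl fun j _ => ?_
  have hj := h j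
  simp only [blockLabel, Prod.mk.injEq] at hj
  rw [hj.2.2.1, hj.2.2.2, Function.comp]

theorem length_comp {c : ℕ} {z : Fin c → Z} {l : Fin c → ℕ} {π : Equiv.Perm (Fin c)}
    (hπ : π ∈ P.blockPerms z l) {y : Fin c → List X} (hy : ∀ j, (y j).length = l j) (j : Fin c) :
    ((y ∘ π) j).length = l j := by
  have hj := (Finset.mem_filter.1 hπ).2 j
  simp only [blockLabel, Prod.mk.injEq] at hj
  rw [Function.comp, hy, hj.2.1]

/-- Distinct rearrangements of distinct blocks give distinct words. -/
theorem injOn_flatten_comp {c : ℕ} {z : Fin c → Z} {l : Fin c → ℕ} {y : Fin c → List X}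
    (hy : ∀ j, (y j).length = l j)
    (hinj : ∀ i j : Fin c, i.val + 1 ≠ c → j.val + 1 ≠ c → y i = y j → i = j) :
    Set.InjOn (fun π : Equiv.Perm (Fin c) => (List.ofFn (y ∘ π)).flatten) (P.blockPerms z l) := by
  intro π hπ σ hσ h
  have h1 := ofFn_flatten_injective
    (fun j => (P.length_comp hπ hy j).trans (P.length_comp hσ hy j).symm) h
  ext j : 1
  have hpj := (Finset.mem_filter.1 hπ).2 j
  have hsj := (Finset.mem_filter.1 hσ).2 j
  simp only [blockLabel, Prod.mk.injEq, decide_eq_decide] at hpj hsj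
  -- The Boolean in the label pins the last block, the only one that may coincide with another.
  by_cases hj : j.val + 1 = c
  · have h2 := hpj.1.2 hj
    have h3 := hsj.1.2 hj
    ext; omega
  · exact hinj _ _ (fun h => hj (hpj.1.1 h)) (fun h => hj (hsj.1.1 h)) (congrFun h1 j)

/-- The product distribution takes a geometric weight for the length and the constant 1 / (2 (|Z| +
1)²) for the flag and the two states; c^c ≤ e^c c! supplies the factor e^c. -/
theorem pow_self_le_card_blockPerms {c n : ℕ} (z : Fin c → Z) (l : Fin c → ℕ)
    (hl : ∑ j, l j = n) {η : ℝ} (hη : 0 < η) :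
    (c : ℝ) ^ c ≤ (2 * Real.exp 1 * (Fintype.card Z + 1) ^ 2 * ((1 + η) / η)) ^ c * (1 + η) ^ n *
      (P.blockPerms z l).card := by
  set s : ℝ := Fintype.card Z + 1 with hs
  have hs0 : 0 < s := by positivity
  have hZ : (Fintype.card Z : ℝ) ≤ s := by linarith
  have h1 := factorial_mul_prod_le_card_perm (P.blockLabel z l)
    (Finset.univ ×ˢ Finset.range (n + 1) ×ˢ Finset.univ ×ˢ Finset.univ) (by
      intro j
      simp only [blockLabel, Finset.mem_product, Finset.mem_univ, true_and, and_true,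
        Finset.mem_range]
      refine Nat.lt_succ_of_le (hl ▸ ?_)
      exact Finset.single_le_sum (fun _ _ => Nat.zero_le _) (Finset.mem_univ j))
    (fun a => lengthWeight η a.2.1 * (2 * s ^ 2)⁻¹)
    (fun a => mul_nonneg (lengthWeight_pos hη _).le (by positivity)) (by
      simp only [Finset.sum_product, Finset.sum_const, Finset.card_univ, nsmul_eq_mul,
        Fintype.card_bool, ← Finset.mul_sum, ← Finset.sum_mul]
      have h2 := sum_lengthWeight_le_one hη (n + 1)
      have h3 : (Fintype.card Z : ℝ) * (Fintype.card Z) ≤ s ^ 2 := by nlinarith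
      have h4 : 0 ≤ ∑ k ∈ Finset.range (n + 1), lengthWeight η k :=
        Finset.sum_nonneg fun k _ => (lengthWeight_pos hη k).le
      calc _ = (∑ k ∈ Finset.range (n + 1), lengthWeight η k) *
            (((Fintype.card Z : ℝ) * (Fintype.card Z)) / s ^ 2) := by
              rw [Finset.card_product, Finset.card_univ]; push_cast; field_simp
        _ ≤ 1 * 1 := by
            gcongr
            rw [div_le_one (by positivity)]; exact h3
        _ = 1 := one_mul 1)
  have h5 : (∏ j, (fun a : Bool × ℕ × Z × Z => lengthWeight η a.2.1 * (2 * s ^ 2)⁻¹)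
      (P.blockLabel z l j)) =
      ((2 * s ^ 2 * ((1 + η) / η)) ^ c * (1 + η) ^ n)⁻¹ := by
    simp only [blockLabel, Finset.prod_mul_distrib, prod_lengthWeight, hl, Finset.prod_const,
      Finset.card_univ, Fintype.card_fin]
    rw [mul_inv (_ ^ c), ← inv_pow (2 * s ^ 2 * ((1 + η) / η)), ← inv_pow (1 + η), mul_inv (2 * s ^ 2),
      inv_div, mul_pow (2 * s ^ 2)⁻¹]
    ring
  rw [h5, ← div_eq_mul_inv, div_le_iff₀ (by positivity)] at h1
  have h6 : (c : ℝ) ^ c ≤ Real.exp 1 ^ c * c.factorial := by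
    have := Real.pow_div_factorial_le_exp (c : ℝ) (Nat.cast_nonneg c) c
    rw [div_le_iff₀ (by positivity)] at this
    rwa [← Real.exp_nat_mul, mul_one]
  refine h6.trans ?_
  calc Real.exp 1 ^ c * (c.factorial : ℝ) ≤ Real.exp 1 ^ c * ((P.blockPerms z l).card *
        ((2 * s ^ 2 * ((1 + η) / η)) ^ c * (1 + η) ^ n)) := by gcongr; exact h1
    _ = _ := by
      rw [mul_comm 2 (Real.exp 1), mul_assoc (Real.exp 1), mul_assoc (Real.exp 1),
        mul_pow (Real.exp 1)]
      ring

theorem flatten_comp_mem_listWords {n c : ℕ} {z : Fin c → Z} {l : Fin c → ℕ}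
    (hl : ∑ j, l j = n) {π : Equiv.Perm (Fin c)} (hπ : π ∈ P.blockPerms z l)
    {y : Fin c → List X} (hy : ∀ j, (y j).length = l j) :
    (List.ofFn (y ∘ π)).flatten ∈ listWords X n := by
  rw [mem_listWords, length_ofFn_flatten, ← hl]
  exact Finset.sum_congr rfl fun j _ => P.length_comp hπ hy j

end FiniteStateSource

/-! ### The phrases as blocks, and Ziv's inequality -/

section Phrases

variable {X : Type*} [DecidableEq X]

/-- The phrases of a word, indexed by `Fin c`. -/
def phrase (w : List X) (c : ℕ) (j : Fin c) : List X := (lzParse w).getD j []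

theorem ofFn_phrase {w : List X} {c : ℕ} (h : (lzParse w).length = c) :
    List.ofFn (phrase w c) = lzParse w := by
  refine List.ext_getElem (by simp [h]) fun i h1 h2 => ?_
  simp [phrase, h2]

theorem flatten_ofFn_phrase {w : List X} {c : ℕ} (h : (lzParse w).length = c) :
    (List.ofFn (phrase w c)).flatten = w := by
  rw [ofFn_phrase h, flatten_lzParse]

theorem phrase_injective_of_not_last {w : List X} {c : ℕ} (h : (lzParse w).length = c)
    (i j : Fin c) (hi : i.val + 1 ≠ c) (hj : j.val + 1 ≠ c) (hij : phrase w c i = phrase w c j) :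
    i = j := by
  have hi' : i.val < (lzParse w).dropLast.length := by simp; omega
  have hj' : j.val < (lzParse w).dropLast.length := by simp; omega
  refine Fin.ext ((nodup_dropLast_lzParse w).getElem_inj_iff (hi := hi') (hj := hj') |>.1 ?_)
  have hi2 : i.val < (lzParse w).length := by omega
  have hj2 : j.val < (lzParse w).length := by omega
  simpa [phrase, hi2, hj2] using hij

end Phrases

namespace FiniteStateSource

variable {X Z : Type*} [Fintype X] [DecidableEq X] [Fintype Z] [DecidableEq Z]
  (P : FiniteStateSource X Z)

/-- Summing a nonnegative function over the rearrangements of a word gives at most its sum over all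
words. -/
theorem sum_blockPerms_le {n c : ℕ} {z : Fin c → Z} {l : Fin c → ℕ} (hl : ∑ j, l j = n)
    {w : List X} (hc : (lzParse w).length = c) (hy : ∀ j, (phrase w c j).length = l j)
    (f : List X → ℝ) (hf : ∀ v ∈ listWords X n, 0 ≤ f v) :
    ∑ π ∈ P.blockPerms z l, f (List.ofFn (phrase w c ∘ π)).flatten ≤
      ∑ v ∈ listWords X n, f v := by
  have hinj := P.injOn_flatten_comp (z := z) hy (phrase_injective_of_not_last hc)
  rw [← Finset.sum_image (f := f) hinj]
  refine Finset.sum_le_sum_of_subset_of_nonneg ?_ fun v hv _ => hf v hv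
  intro v hv
  obtain ⟨π, hπ, rfl⟩ := Finset.mem_image.1 hv
  exact P.flatten_comp_mem_listWords hl hπ hy

/-- The rearrangements are distinct words, each at least as probable as the common path probability,
and word probabilities sum to 1. -/
theorem pathProb_mul_card_le_one {n c : ℕ} (z : Fin c → Z) {l : Fin c → ℕ} (hl : ∑ j, l j = n)
    {w : List X} (hc : (lzParse w).length = c) (hy : ∀ j, (phrase w c j).length = l j) :
    P.pathProb z (phrase w c) * (P.blockPerms z l).card ≤ 1 := by
  calc P.pathProb z (phrase w c) * (P.blockPerms z l).card
      = ∑ π ∈ P.blockPerms z l, P.pathProb z (phrase w c ∘ π) := by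
        rw [Finset.sum_congr rfl fun π hπ => P.pathProb_comp hπ _, Finset.sum_const, nsmul_eq_mul,
          mul_comm]
    _ ≤ ∑ π ∈ P.blockPerms z l, P.listProb (List.ofFn (phrase w c ∘ π)).flatten :=
        Finset.sum_le_sum fun π _ => P.pathProb_le_listProb _ _
    _ ≤ ∑ v ∈ listWords X n, P.listProb v :=
        P.sum_blockPerms_le hl hc hy _ fun v _ => P.listProb_nonneg v
    _ = 1 := P.sum_listProb n

theorem card_blockPerms_le {n c : ℕ} (z : Fin c → Z) {l : Fin c → ℕ} (hl : ∑ j, l j = n)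
    {w : List X} (hc : (lzParse w).length = c) (hy : ∀ j, (phrase w c j).length = l j) :
    ((P.blockPerms z l).card : ℝ) ≤ (Fintype.card X : ℝ) ^ n := by
  have := P.sum_blockPerms_le (z := z) hl hc hy (fun _ => 1) fun _ _ => zero_le_one
  simpa [card_listWords] using this

theorem sum_length_phrase {n c : ℕ} {w : List X} (hw : w ∈ listWords X n)
    (hc : (lzParse w).length = c) : ∑ j, (phrase w c j).length = n := by
  rw [← length_ofFn_flatten, flatten_ofFn_phrase hc, mem_listWords.1 hw]

/-- Ziv's inequality for finite-state sources. -/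
theorem listProb_mul_pow_self_le {n c : ℕ} {w : List X} (hw : w ∈ listWords X n)
    (hc : (lzParse w).length = c) {D : ℝ}
    (hD : ∀ z : Fin c → Z, (c : ℝ) ^ c ≤
      D * (P.blockPerms z fun j => (phrase w c j).length).card) (hD0 : 0 ≤ D) :
    P.listProb w * (c : ℝ) ^ c ≤ (Fintype.card Z : ℝ) ^ c * D := by
  have h : ∀ z : Fin c → Z, P.pathProb z (phrase w c) * (c : ℝ) ^ c ≤ D := by
    intro z
    calc _ ≤ P.pathProb z (phrase w c) *
          (D * (P.blockPerms z fun j => (phrase w c j).length).card) :=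
          mul_le_mul_of_nonneg_left (hD z) (P.pathProb_nonneg _ _)
      _ = D * (P.pathProb z (phrase w c) *
          (P.blockPerms z fun j => (phrase w c j).length).card) := by ring
      _ ≤ D * 1 := mul_le_mul_of_nonneg_left
          (P.pathProb_mul_card_le_one z (sum_length_phrase hw hc) hc fun _ => rfl) hD0
      _ = D := mul_one D
  conv_lhs => rw [← flatten_ofFn_phrase hc, listProb_flatten, Finset.sum_mul]
  refine (Finset.sum_le_sum fun z _ => h z).trans_eq ?_
  simp [Finset.card_univ]

/-- The contribution of the words with given phrase lengths and given states at the phrase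
boundaries, bounded by averaging over the rearrangements of the phrases. -/
theorem sum_pathProb_le {n c : ℕ} {l : Fin c → ℕ} (hl : ∑ j, l j = n) (z : Fin c → Z)
    (A : Finset (List X)) (hA : ∀ w ∈ A, (lzParse w).length = c)
    (hA' : ∀ w ∈ A, ∀ j, (phrase w c j).length = l j)
    (g : List X → ℝ) (hg : ∀ v ∈ listWords X n, 0 < g v) {H D ρ : ℝ} (hH0 : 0 < H)
    (hH : ∑ v ∈ listWords X n, 1 / g v ≤ H) (hD0 : 0 < D)
    (hD : (c : ℝ) ^ c ≤ D * (P.blockPerms z l).card) (hρ : 0 < ρ) :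
    ∑ w ∈ A, P.pathProb z (phrase w c) * ((c : ℝ) ^ c) ^ ρ ≤
      (D * H) ^ ρ * ∑ v ∈ listWords X n, P.listProb v * g v ^ ρ := by
  set S := P.blockPerms z l with hS
  have hS0 : 0 < (S.card : ℝ) := by
    have : (1 : Equiv.Perm (Fin c)) ∈ S := by simp [hS, blockPerms]
    exact_mod_cast Finset.card_pos.2 ⟨1, this⟩
  -- Jensen over the rearrangements of one word: the mean of 1 / g is at most H / |S|, and `hD`
  -- trades |S| for c^c / D.
  have h1 : ∀ w ∈ A, (S.card : ℝ) * ((c : ℝ) ^ c) ^ ρ ≤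
      (D * H) ^ ρ * ∑ π ∈ S, g (List.ofFn (phrase w c ∘ π)).flatten ^ ρ := by
    intro w hw
    have hgp : ∀ π ∈ S, 0 < g (List.ofFn (phrase w c ∘ π)).flatten := fun π hπ =>
      hg _ (P.flatten_comp_mem_listWords hl hπ (hA' w hw))
    have h2 := sum_le_rpow_mul_sum_mul_rpow S (fun _ => (1 : ℝ))
      (fun π => g (List.ofFn (phrase w c ∘ π)).flatten) (b := H / S.card) (ρ := ρ)
      (fun _ _ => zero_le_one) hgp (by positivity) hρ (by
        have := P.sum_blockPerms_le (z := z) hl (hA w hw) (hA' w hw) (fun v => 1 / g v)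
          fun v hv => (one_div_pos.2 (hg v hv)).le
        simp only [Finset.sum_const, nsmul_eq_mul, mul_one]
        rw [div_mul_cancel₀ _ hS0.ne']
        exact this.trans hH)
    simp only [Finset.sum_const, nsmul_eq_mul, mul_one, one_mul] at h2
    have h3 : 0 ≤ ∑ π ∈ S, g (List.ofFn (phrase w c ∘ π)).flatten ^ ρ :=
      Finset.sum_nonneg fun π hπ => Real.rpow_nonneg (hgp π hπ).le _
    calc (S.card : ℝ) * ((c : ℝ) ^ c) ^ ρ
        ≤ ((H / S.card) ^ ρ * ∑ π ∈ S, g (List.ofFn (phrase w c ∘ π)).flatten ^ ρ) *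
          (D * S.card) ^ ρ := by
          refine mul_le_mul h2 (Real.rpow_le_rpow (by positivity) hD hρ.le) (by positivity) ?_
          exact mul_nonneg (by positivity) h3
      _ = ((H / S.card) * (D * S.card)) ^ ρ *
          ∑ π ∈ S, g (List.ofFn (phrase w c ∘ π)).flatten ^ ρ := by
          rw [Real.mul_rpow (x := H / S.card) (by positivity) (by positivity)]; ring
      _ = _ := by
          congr 2; field_simp
  -- For fixed π the rearranged word determines w, since its block lengths are known and π is
  -- invertible. Hence no word on the right is used twice.
  have h4 : ∀ π ∈ S, ∑ w ∈ A, P.pathProb z (phrase w c) *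
      g (List.ofFn (phrase w c ∘ π)).flatten ^ ρ ≤
      ∑ v ∈ listWords X n, P.listProb v * g v ^ ρ := by
    intro π hπ
    have hinj : Set.InjOn (fun w : List X => (List.ofFn (phrase w c ∘ π)).flatten) A := by
      intro w hw v hv h
      have h5 := ofFn_flatten_injective (fun j => (P.length_comp hπ (hA' w hw) j).trans
        (P.length_comp hπ (hA' v hv) j).symm) h
      have h6 : phrase w c = phrase v c := π.surjective.injective_comp_right h5
      rw [← flatten_ofFn_phrase (hA w hw), h6, flatten_ofFn_phrase (hA v hv)]
    calc _ ≤ ∑ w ∈ A, P.listProb (List.ofFn (phrase w c ∘ π)).flatten *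
          g (List.ofFn (phrase w c ∘ π)).flatten ^ ρ := by
          refine Finset.sum_le_sum fun w hw => mul_le_mul_of_nonneg_right ?_ ?_
          · rw [← P.pathProb_comp hπ]; exact P.pathProb_le_listProb _ _
          · exact Real.rpow_nonneg
              (hg _ (P.flatten_comp_mem_listWords hl hπ (hA' w hw))).le _
      _ = ∑ v ∈ A.image (fun w : List X => (List.ofFn (phrase w c ∘ π)).flatten),
          P.listProb v * g v ^ ρ :=
          (Finset.sum_image (f := fun v => P.listProb v * g v ^ ρ) hinj).symm
      _ ≤ _ := by
          refine Finset.sum_le_sum_of_subset_of_nonneg ?_ fun v hv _ =>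
            mul_nonneg (P.listProb_nonneg v) (Real.rpow_nonneg (hg v hv).le _)
          intro v hv
          obtain ⟨w, hw, rfl⟩ := Finset.mem_image.1 hv
          exact P.flatten_comp_mem_listWords hl hπ (hA' w hw)
  refine le_of_mul_le_mul_left ?_ hS0
  calc (S.card : ℝ) * ∑ w ∈ A, P.pathProb z (phrase w c) * ((c : ℝ) ^ c) ^ ρ
      = ∑ w ∈ A, P.pathProb z (phrase w c) * (S.card * ((c : ℝ) ^ c) ^ ρ) := by
        rw [Finset.mul_sum]; exact Finset.sum_congr rfl fun w _ => by ring
    _ ≤ ∑ w ∈ A, P.pathProb z (phrase w c) *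
        ((D * H) ^ ρ * ∑ π ∈ S, g (List.ofFn (phrase w c ∘ π)).flatten ^ ρ) :=
        Finset.sum_le_sum fun w hw =>
          mul_le_mul_of_nonneg_left (h1 w hw) (P.pathProb_nonneg _ _)
    _ = (D * H) ^ ρ * ∑ π ∈ S, ∑ w ∈ A, P.pathProb z (phrase w c) *
        g (List.ofFn (phrase w c ∘ π)).flatten ^ ρ := by
        rw [Finset.sum_comm, Finset.mul_sum]
        refine Finset.sum_congr rfl fun w _ => ?_
        rw [← Finset.mul_sum]; ring
    _ ≤ (D * H) ^ ρ * ∑ _π ∈ S, ∑ v ∈ listWords X n, P.listProb v * g v ^ ρ :=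
        mul_le_mul_of_nonneg_left (Finset.sum_le_sum h4) (by positivity)
    _ = _ := by rw [Finset.sum_const, nsmul_eq_mul]; ring

end FiniteStateSource

/-! ### Uniform bounds over all phrase-length sequences -/

/-- An upper bound for the number of label sequences of at most `η * n` blocks with total length
`n`. -/
noncomputable def labelBound (s n : ℕ) (η : ℝ) : ℝ :=
  (2 * Real.exp 1 * (s + 1) ^ 2 * ((1 + η) / η)) ^ (η * n) * (1 + η) ^ n

theorem pow_mul_pow_le_labelBound {s n c : ℕ} {η : ℝ} (hη : 0 < η) (hc : (c : ℝ) ≤ η * n) :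
    (2 * Real.exp 1 * (s + 1) ^ 2 * ((1 + η) / η)) ^ c * (1 + η) ^ n ≤ labelBound s n η := by
  unfold labelBound
  gcongr
  rw [← Real.rpow_natCast]
  -- The base is at least 1, so the exponent c may be raised to η n, which no longer depends on the
  -- word.
  refine Real.rpow_le_rpow_of_exponent_le ?_ hc
  have h1 : (1 : ℝ) ≤ Real.exp 1 := Real.one_le_exp zero_le_one
  have h2 : (1 : ℝ) ≤ ((s : ℝ) + 1) ^ 2 := one_le_pow₀ (by linarith [Nat.cast_nonneg (α := ℝ) s])
  have h3 : 1 ≤ (1 + η) / η := by rw [one_le_div hη]; linarith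
  have h4 : 1 ≤ 2 * Real.exp 1 := by linarith
  exact one_le_mul_of_one_le_of_one_le (one_le_mul_of_one_le_of_one_le h4 h2) h3

theorem one_le_labelBound (s n : ℕ) {η : ℝ} (hη : 0 < η) : 1 ≤ labelBound s n η := by
  have := pow_mul_pow_le_labelBound (s := s) (n := n) (c := 0) hη (by simp; positivity)
  refine le_trans ?_ this
  simpa using one_le_pow₀ (by linarith : 1 ≤ 1 + η)

theorem pow_mul_pow_mul_pow_le_labelBound {s n c : ℕ} {η : ℝ} (hη : 0 < η)
    (hc : (c : ℝ) ≤ η * n) :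
    (s : ℝ) ^ c * (((1 + η) / η) ^ c * (1 + η) ^ n) ≤ labelBound s n η := by
  refine le_trans ?_ (pow_mul_pow_le_labelBound (s := s) hη hc)
  rw [← mul_assoc, ← mul_pow]
  gcongr
  have h1 : (1 : ℝ) ≤ Real.exp 1 := Real.one_le_exp zero_le_one
  nlinarith [Nat.cast_nonneg (α := ℝ) s]

section PhraseLengths

variable {X : Type*} [DecidableEq X]

/-- The list of the phrase lengths of a word. -/
def phraseLengths (w : List X) : List ℕ := (lzParse w).map List.length

theorem length_phrase_eq {w : List X} {L : List ℕ} (h : phraseLengths w = L) (j : Fin L.length) :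
    (phrase w L.length j).length = L.get j := by
  subst h
  have : j.val < (lzParse w).length := by simpa [phraseLengths] using j.2
  rw [List.get_eq_getElem]
  simp [phraseLengths, phrase, this]

/-- Counts phrase lengths together with boundary states. The factor n + 1 comes from splitting by
the number of phrases. -/
theorem sum_pow_length_le [Fintype X] {n : ℕ} {η : ℝ} (hη : 0 < η)
    (hc : ∀ w ∈ listWords X n, ((lzParse w).length : ℝ) ≤ η * n) (s : ℕ) :
    ∑ L ∈ (listWords X n).image phraseLengths, (s : ℝ) ^ L.length ≤
      (n + 1) * labelBound s n η := by
  have hprop : ∀ L ∈ (listWords X n).image phraseLengths,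
      L.sum = n ∧ (L.length : ℝ) ≤ η * n ∧ L.length ≤ n := by
    intro L hL
    obtain ⟨w, hw, rfl⟩ := Finset.mem_image.1 hL
    have hlen := mem_listWords.1 hw
    refine ⟨(sum_map_length_lzParse w).trans hlen, ?_, ?_⟩
    · simpa [phraseLengths] using hc w hw
    · simpa [phraseLengths, hlen] using length_lzParse_le w
  rw [← Finset.sum_fiberwise_of_maps_to (t := Finset.range (n + 1)) (g := List.length)
    fun L hL => Finset.mem_range.2 (Nat.lt_succ_of_le (hprop L hL).2.2)]
  have h1 : ∀ c ∈ Finset.range (n + 1),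
      ∑ L ∈ ((listWords X n).image phraseLengths).filter (fun L => L.length = c),
        (s : ℝ) ^ L.length ≤ labelBound s n η := by
    intro c _
    set A := ((listWords X n).image phraseLengths).filter (fun L => L.length = c) with hA
    have hA1 : ∀ L ∈ A, L.length = c := fun L hL => (Finset.mem_filter.1 hL).2
    have hA2 := fun L (hL : L ∈ A) => hprop L (Finset.mem_filter.1 hL).1
    rw [Finset.sum_congr rfl fun L hL => by rw [hA1 L hL], Finset.sum_const, nsmul_eq_mul]
    rcases A.eq_empty_or_nonempty with h | ⟨L, hL⟩
    · rw [h]; simpa using zero_le_one.trans (one_le_labelBound s n hη)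
    · refine le_trans ?_ (pow_mul_pow_mul_pow_le_labelBound (s := s) hη
        (hA1 L hL ▸ (hA2 L hL).2.1))
      rw [mul_comm]
      gcongr
      exact card_le_of_length_of_sum hη A hA1 fun L hL => (hA2 L hL).1
  refine (Finset.sum_le_sum h1).trans_eq ?_
  simp

end PhraseLengths

/-! ### The two converse bounds -/

namespace FiniteStateSource

variable {X Z : Type*} [Fintype X] [Fintype Z] [DecidableEq Z] (P : FiniteStateSource X Z)

theorem pow_self_le_labelBound_mul_card {n c : ℕ} (z : Fin c → Z) (l : Fin c → ℕ)
    (hl : ∑ j, l j = n) {η : ℝ} (hη : 0 < η) (hc : (c : ℝ) ≤ η * n) :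
    (c : ℝ) ^ c ≤ labelBound (Fintype.card Z) n η * (P.blockPerms z l).card :=
  (P.pow_self_le_card_blockPerms z l hl hη).trans
    (mul_le_mul_of_nonneg_right (pow_mul_pow_le_labelBound hη hc) (Nat.cast_nonneg _))

variable [DecidableEq X]

/-- The bound obtained from rearrangements of phrases; it is good when `ρ` is not too small. -/
theorem sum_listProb_mul_le_of_rearrangement {n : ℕ} {η : ℝ} (hη : 0 < η)
    (hc : ∀ w ∈ listWords X n, ((lzParse w).length : ℝ) ≤ η * n)
    (g : List X → ℝ) (hg : ∀ v ∈ listWords X n, 0 < g v) {H ρ : ℝ} (hH0 : 0 < H)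
    (hH : ∑ v ∈ listWords X n, 1 / g v ≤ H) (hρ : 0 < ρ) :
    ∑ w ∈ listWords X n,
        P.listProb w * (((lzParse w).length : ℝ) ^ (lzParse w).length) ^ ρ ≤
      (n + 1) * labelBound (Fintype.card Z) n η * (labelBound (Fintype.card Z) n η * H) ^ ρ *
        ∑ v ∈ listWords X n, P.listProb v * g v ^ ρ := by
  set D := labelBound (Fintype.card Z) n η with hDdef
  have hD0 : 0 < D := zero_lt_one.trans_le (one_le_labelBound _ _ hη)
  set R := ∑ v ∈ listWords X n, P.listProb v * g v ^ ρ with hR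
  have hR0 : 0 ≤ R := Finset.sum_nonneg fun v hv =>
    mul_nonneg (P.listProb_nonneg v) (Real.rpow_nonneg (hg v hv).le _)
  rw [← Finset.sum_fiberwise_of_maps_to (t := (listWords X n).image phraseLengths)
    (g := phraseLengths) fun w hw => Finset.mem_image_of_mem _ hw]
  have h1 : ∀ L ∈ (listWords X n).image phraseLengths,
      ∑ w ∈ (listWords X n).filter (fun w => phraseLengths w = L),
        P.listProb w * (((lzParse w).length : ℝ) ^ (lzParse w).length) ^ ρ ≤
      (Fintype.card Z : ℝ) ^ L.length * ((D * H) ^ ρ * R) := by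
    intro L hL
    have hlen : ∀ w ∈ (listWords X n).filter (fun w => phraseLengths w = L),
        (lzParse w).length = L.length := by
      intro w hw
      rw [← (Finset.mem_filter.1 hw).2]; simp [phraseLengths]
    have hsumL : ∑ j, L.get j = n := by
      obtain ⟨w, hw, rfl⟩ := Finset.mem_image.1 hL
      rw [← List.sum_ofFn, List.ofFn_get]
      exact (sum_map_length_lzParse w).trans (mem_listWords.1 hw)
    have hcL : (L.length : ℝ) ≤ η * n := by
      obtain ⟨w, hw, rfl⟩ := Finset.mem_image.1 hL
      simpa [phraseLengths] using hc w hw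
    calc _ = ∑ w ∈ (listWords X n).filter (fun w => phraseLengths w = L),
          ∑ z : Fin L.length → Z, P.pathProb z (phrase w L.length) *
            ((L.length : ℝ) ^ L.length) ^ ρ := by
          refine Finset.sum_congr rfl fun w hw => ?_
          rw [← Finset.sum_mul, ← P.listProb_flatten, flatten_ofFn_phrase (hlen w hw), hlen w hw]
      _ = ∑ z : Fin L.length → Z, ∑ w ∈ (listWords X n).filter (fun w => phraseLengths w = L),
            P.pathProb z (phrase w L.length) * ((L.length : ℝ) ^ L.length) ^ ρ :=
          Finset.sum_comm
      _ ≤ ∑ _z : Fin L.length → Z, (D * H) ^ ρ * R := by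
          refine Finset.sum_le_sum fun z _ => ?_
          exact P.sum_pathProb_le hsumL z _ hlen
            (fun w hw => length_phrase_eq (Finset.mem_filter.1 hw).2) g hg hH0 hH hD0
            (P.pow_self_le_labelBound_mul_card z _ hsumL hη hcL) hρ
      _ = _ := by simp [Finset.card_univ]
  refine (Finset.sum_le_sum h1).trans ?_
  rw [← Finset.sum_mul]
  calc _ ≤ ((n + 1) * D) * ((D * H) ^ ρ * R) := by
        gcongr
        exact sum_pow_length_le hη hc _
    _ = _ := by ring

/-- The bound obtained from Ziv's inequality; it is good when `ρ` is small. -/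
theorem sum_listProb_mul_le_of_ziv {n : ℕ} {η : ℝ} (hη : 0 < η)
    (hc : ∀ w ∈ listWords X n, ((lzParse w).length : ℝ) ≤ η * n)
    (g : List X → ℝ) (hg : ∀ v ∈ listWords X n, 0 < g v) {H ρ : ℝ} (hH0 : 0 < H)
    (hH : ∑ v ∈ listWords X n, 1 / g v ≤ H) (hρ : 0 < ρ) :
    ∑ w ∈ listWords X n,
        P.listProb w * (((lzParse w).length : ℝ) ^ (lzParse w).length) ^ ρ ≤
      (labelBound (Fintype.card Z) n η ^ 2 * H *
          (labelBound (Fintype.card Z) n η * (Fintype.card X : ℝ) ^ n) ^ ρ) ^ ρ *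
        ∑ v ∈ listWords X n, P.listProb v * g v ^ ρ := by
  set D := labelBound (Fintype.card Z) n η with hDdef
  have hD1 : 1 ≤ D := one_le_labelBound _ _ hη
  have hD0 : 0 < D := zero_lt_one.trans_le hD1
  set F : List X → ℝ := fun w => ((lzParse w).length : ℝ) ^ (lzParse w).length with hF
  have hF1 : ∀ w, 1 ≤ F w := by
    intro w
    simp only [hF]
    rcases Nat.eq_zero_or_pos (lzParse w).length with h | h
    · simp [h]
    · exact one_le_pow₀ (by exact_mod_cast h)
  have hF0 : ∀ w, 0 < F w := fun w => zero_lt_one.trans_le (hF1 w)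
  have hX0 : 0 < (Fintype.card X : ℝ) ^ n := by
    by_contra h
    have h0 : (listWords X n).card = 0 := by
      rw [card_listWords]
      exact_mod_cast le_antisymm (not_lt.1 h) (by positivity)
    have := P.sum_listProb n
    rw [Finset.card_eq_zero.1 h0] at this
    simp at this
  have hFD : ∀ w ∈ listWords X n, F w ≤ D * (Fintype.card X : ℝ) ^ n := by
    intro w hw
    have hl := sum_length_phrase hw rfl
    refine (P.pow_self_le_labelBound_mul_card (fun _ => P.init) _ hl hη (hc w hw)).trans ?_
    exact mul_le_mul_of_nonneg_left (P.card_blockPerms_le _ hl rfl fun _ => rfl) hD0.le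
  have hPF : ∀ w ∈ listWords X n, P.listProb w * F w ≤ D ^ 2 := by
    intro w hw
    have hl := sum_length_phrase hw rfl
    refine (P.listProb_mul_pow_self_le hw rfl
      (fun z => P.pow_self_le_labelBound_mul_card z _ hl hη (hc w hw)) hD0.le).trans ?_
    rw [sq]
    refine mul_le_mul_of_nonneg_right ?_ hD0.le
    refine le_trans ?_ (pow_mul_pow_mul_pow_le_labelBound hη (hc w hw))
    refine le_mul_of_one_le_right (by positivity) ?_
    refine one_le_mul_of_one_le_of_one_le (one_le_pow₀ ?_) (one_le_pow₀ (by linarith))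
    rw [one_le_div hη]; linarith
  -- The tilted weights have total mass at least 1, so the bound on their sum against F / g needs no
  -- normalization.
  have hsum1 : 1 ≤ ∑ w ∈ listWords X n, P.listProb w * F w ^ ρ := by
    rw [← P.sum_listProb n]
    exact Finset.sum_le_sum fun w _ => le_mul_of_one_le_right (P.listProb_nonneg w)
      (Real.one_le_rpow (hF1 w) hρ.le)
  -- Tilting by F^ρ makes the right side collapse: P F^ρ (g / F)^ρ = P g^ρ.
  have hmain := sum_le_rpow_mul_sum_mul_rpow (listWords X n) (fun w => P.listProb w * F w ^ ρ)
    (fun w => g w / F w) (b := D ^ 2 * H * (D * (Fintype.card X : ℝ) ^ n) ^ ρ) (ρ := ρ)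
    (fun w _ => mul_nonneg (P.listProb_nonneg w) (Real.rpow_nonneg (hF0 w).le _))
    (fun w hw => div_pos (hg w hw) (hF0 w)) (by positivity) hρ (by
      refine le_trans ?_ (le_mul_of_one_le_right (by positivity) hsum1)
      calc _ ≤ ∑ w ∈ listWords X n,
            D ^ 2 * (D * (Fintype.card X : ℝ) ^ n) ^ ρ * (1 / g w) := by
            refine Finset.sum_le_sum fun w hw => ?_
            have hgw := hg w hw
            calc _ = (P.listProb w * F w) * F w ^ ρ * (1 / g w) := by
                  field_simp
              _ ≤ _ := by
                  have h1 := hPF w hw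
                  have h2 := Real.rpow_le_rpow (hF0 w).le (hFD w hw) hρ.le
                  have h3 := Real.rpow_nonneg (hF0 w).le ρ
                  gcongr
        _ ≤ D ^ 2 * (D * (Fintype.card X : ℝ) ^ n) ^ ρ * H := by
            rw [← Finset.mul_sum]
            gcongr
        _ = _ := by ring)
  refine hmain.trans_eq ?_
  congr 1
  refine Finset.sum_congr rfl fun w hw => ?_
  rw [Real.div_rpow (hg w hw).le (hF0 w).le, mul_assoc,
    mul_div_cancel₀ _ (Real.rpow_pos_of_pos (hF0 w) ρ).ne']

end FiniteStateSource

/-! ### Asymptotics of the rates -/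

/-- An upper bound for the number of phrases per letter. -/
noncomputable def phraseRate (α n : ℕ) : ℝ :=
  (1 + √n) / n + 1 / ((Nat.log ((α + 2) ^ 2) n : ℝ) + 1)

theorem phraseRate_pos (α n : ℕ) : 0 < phraseRate α n := by
  unfold phraseRate; positivity

theorem length_lzParse_le_phraseRate_mul {X : Type*} [DecidableEq X] [Fintype X] {n : ℕ}
    {w : List X} (hw : w ∈ listWords X n) :
    ((lzParse w).length : ℝ) ≤ phraseRate (Fintype.card X) n * n := by
  have hlen := mem_listWords.1 hw
  rcases Nat.eq_zero_or_pos n with rfl | hn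
  · have := length_lzParse_le w
    rw [hlen, Nat.le_zero] at this
    simp [this]
  · set α := Fintype.card X
    -- The base (α + 2)² makes the bound (α + 1)^k on the number of short phrases at most √n, while
    -- k still tends to infinity.
    set k := Nat.log ((α + 2) ^ 2) n with hk
    have h1 : ((lzParse w).length : ℝ) * (k + 1) ≤ (1 + (α + 1) ^ k) * (k + 1) + n := by
      have := length_lzParse_mul_le w k
      rw [hlen] at this
      exact_mod_cast this
    have h2 : ((α : ℝ) + 1) ^ k ≤ √n := by
      refine Real.le_sqrt_of_sq_le ?_
      have h3 : ((α + 2) ^ 2) ^ k ≤ n := Nat.pow_log_le_self _ hn.ne'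
      have h4 : (((α : ℝ) + 2) ^ 2) ^ k ≤ n := by exact_mod_cast h3
      rw [← pow_mul, mul_comm k 2, pow_mul]
      refine le_trans ?_ h4
      gcongr
      norm_num
    have hn' : (0 : ℝ) < n := by exact_mod_cast hn
    have hk0 : (0 : ℝ) < k + 1 := by positivity
    calc ((lzParse w).length : ℝ) ≤ (1 + (α + 1) ^ k) + n / (k + 1) := by
          rw [← mul_le_mul_iff_left₀ hk0]
          calc _ ≤ _ := h1
            _ = _ := by field_simp
      _ ≤ (1 + √n) + n / (k + 1) := by gcongr
      _ = _ := by rw [phraseRate, ← hk]; field_simp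

theorem tendsto_phraseRate (α : ℕ) :
    Filter.Tendsto (phraseRate α) Filter.atTop (nhds 0) := by
  have h1 : Filter.Tendsto (fun n : ℕ => (1 + √(n : ℝ)) / n) Filter.atTop (nhds 0) := by
    have h2 : Filter.Tendsto (fun n : ℕ => ((n : ℝ))⁻¹ + (√(n : ℝ))⁻¹) Filter.atTop
        (nhds (0 + 0)) :=
      tendsto_inv_atTop_nhds_zero_nat.add (tendsto_inv_atTop_zero.comp
        (Real.tendsto_sqrt_atTop.comp tendsto_natCast_atTop_atTop))
    rw [add_zero] at h2
    refine h2.congr fun n => ?_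
    rw [add_div, Real.sqrt_div_self, one_div]
  have h3 : Filter.Tendsto (fun n : ℕ => Nat.log ((α + 2) ^ 2) n) Filter.atTop Filter.atTop := by
    refine Filter.tendsto_atTop.2 fun m => ?_
    filter_upwards [Filter.eventually_ge_atTop (((α + 2) ^ 2) ^ m)] with n hn
    exact Nat.le_log_of_pow_le (Nat.one_lt_pow two_ne_zero (by omega)) hn
  have h4 : Filter.Tendsto (fun n : ℕ => 1 / ((Nat.log ((α + 2) ^ 2) n : ℝ) + 1)) Filter.atTop
      (nhds 0) := tendsto_one_div_add_atTop_nhds_zero_nat.comp h3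
  rw [← add_zero (0 : ℝ)]
  exact h1.add h4

/-- The logarithm of the number of label sequences, per letter. -/
noncomputable def labelRate (s α n : ℕ) : ℝ :=
  phraseRate α n * Real.logb 2 (2 * Real.exp 1 * (s + 1) ^ 2 *
      ((1 + phraseRate α n) / phraseRate α n)) +
    Real.logb 2 (1 + phraseRate α n) + Real.logb 2 (1 + n * (α + 1)) / n

/-- The exponent also absorbs the harmonic-sum bound H = 1 + n (α + 1). -/
theorem two_rpow_labelRate (s α n : ℕ) :
    (2 : ℝ) ^ (n * labelRate s α n) =
      labelBound s n (phraseRate α n) * (1 + n * (α + 1)) := by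
  have hη := phraseRate_pos α n
  set η := phraseRate α n with hηdef
  have hB : 0 < 2 * Real.exp 1 * ((s : ℝ) + 1) ^ 2 * ((1 + η) / η) := by positivity
  have h1 : (n : ℝ) * labelRate s α n =
      Real.logb 2 (2 * Real.exp 1 * (s + 1) ^ 2 * ((1 + η) / η)) * (η * n) +
        Real.logb 2 (1 + η) * n + Real.logb 2 (1 + n * (α + 1)) := by
    unfold labelRate
    rcases Nat.eq_zero_or_pos n with h | h
    · simp [h]
    · have : (n : ℝ) ≠ 0 := by exact_mod_cast h.ne'
      field_simp
      ring
  rw [h1, Real.rpow_add two_pos, Real.rpow_add two_pos, Real.rpow_mul two_pos.le,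
    Real.rpow_mul two_pos.le, Real.rpow_logb two_pos (by norm_num) hB,
    Real.rpow_logb two_pos (by norm_num) (by positivity),
    Real.rpow_logb two_pos (by norm_num) (by positivity), Real.rpow_natCast]
  rfl

theorem labelRate_nonneg (s α n : ℕ) : 0 ≤ labelRate s α n := by
  rcases Nat.eq_zero_or_pos n with h | h
  · subst h
    have : phraseRate α 0 = 1 := by simp [phraseRate]
    have h1 : (1 : ℝ) ≤ Real.exp 1 := Real.one_le_exp zero_le_one
    have h2 : (1 : ℝ) ≤ ((s : ℝ) + 1) ^ 2 :=
      one_le_pow₀ (by linarith [Nat.cast_nonneg (α := ℝ) s])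
    simp only [labelRate, this]
    have h3 := Real.logb_nonneg (b := 2) (x := 2 * Real.exp 1 * (s + 1) ^ 2 * ((1 + 1) / 1))
      (by norm_num) (by nlinarith)
    have h4 := Real.logb_nonneg (b := 2) (x := 1 + 1) (by norm_num) (by norm_num)
    simp at h3 h4 ⊢
    linarith
  · by_contra hneg
    have h1 : (n : ℝ) * labelRate s α n < 0 :=
      mul_neg_of_pos_of_neg (by exact_mod_cast h) (not_le.1 hneg)
    have h2 := Real.rpow_lt_one_of_one_lt_of_neg (by norm_num : (1 : ℝ) < 2) h1
    rw [two_rpow_labelRate] at h2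
    have h3 := one_le_labelBound s n (phraseRate_pos α n)
    have h4 : (1 : ℝ) ≤ 1 + n * (α + 1) := by
      have : (0 : ℝ) ≤ n * (α + 1) := by positivity
      linarith
    nlinarith

theorem tendsto_labelRate (s α : ℕ) :
    Filter.Tendsto (fun n => labelRate s α n) Filter.atTop (nhds 0) := by
  have hη := tendsto_phraseRate α
  set C : ℝ := 2 * Real.exp 1 * (s + 1) ^ 2 with hC
  have hC0 : 0 < C := by positivity
  have h1 : Filter.Tendsto (fun n => phraseRate α n * Real.logb 2 (C *
      ((1 + phraseRate α n) / phraseRate α n)) + Real.logb 2 (1 + phraseRate α n))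
      Filter.atTop (nhds 0) := by
    -- Expanding the logarithm leaves only t log t as a delicate term, and with log 0 = 0 it is
    -- continuous at 0.
    have h2 : ContinuousAt (fun t : ℝ => (t * Real.log C + t * Real.log (1 + t) - t * Real.log t +
        Real.log (1 + t)) / Real.log 2) 0 := by
      have h3 : ContinuousAt (fun t : ℝ => Real.log (1 + t)) 0 :=
        ContinuousAt.log (by fun_prop) (by norm_num)
      have h4 : ContinuousAt (fun t : ℝ => t * Real.log t) 0 := Real.continuous_mul_log.continuousAt
      exact ((((continuousAt_id.mul continuousAt_const).add (continuousAt_id.mul h3)).sub h4).add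
        h3).div_const _
    have h5 := h2.tendsto.comp hη
    simp only [zero_mul, add_zero, Real.log_one, sub_zero, zero_div] at h5
    refine h5.congr fun n => ?_
    have hp := phraseRate_pos α n
    simp only [Function.comp, Real.logb]
    rw [Real.log_mul hC0.ne' (by positivity), Real.log_div (by positivity) hp.ne']
    ring
  have h6 : Filter.Tendsto (fun n : ℕ => Real.logb 2 (1 + n * ((α : ℝ) + 1)) / n) Filter.atTop
      (nhds 0) := by
    have h7 : Filter.Tendsto (fun n : ℕ => 1 + n * ((α : ℝ) + 1)) Filter.atTop Filter.atTop :=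
      Filter.tendsto_atTop_add_const_left _ _
        (tendsto_natCast_atTop_atTop.atTop_mul_const (by positivity))
    have h8 : Filter.Tendsto (fun x : ℝ => Real.log x / x) Filter.atTop (nhds 0) := by
      simpa using Real.isLittleO_log_id_atTop.tendsto_div_nhds_zero
    have h9 : Filter.Tendsto (fun n : ℕ => (n : ℝ)⁻¹ + ((α : ℝ) + 1)) Filter.atTop
        (nhds (0 + ((α : ℝ) + 1))) := tendsto_inv_atTop_nhds_zero_nat.add_const _
    have h10 := ((h8.comp h7).mul h9).div_const (Real.log 2)
    simp only [zero_mul, zero_div] at h10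
    refine h10.congr' ?_
    filter_upwards [Filter.eventually_gt_atTop 0] with n hn
    have hn' : (n : ℝ) ≠ 0 := by exact_mod_cast hn.ne'
    have hpos : (1 + n * ((α : ℝ) + 1)) ≠ 0 := by positivity
    have h11 : (n : ℝ)⁻¹ + ((α : ℝ) + 1) = (1 + n * ((α : ℝ) + 1)) / n := by field_simp
    simp only [Function.comp, Real.logb]
    rw [h11]
    field_simp
  simpa [labelRate] using h1.add h6

/-- The loss `Δₙ(s, α)` in the converse bound for guessing. -/
noncomputable def guessingLoss (s α n : ℕ) : ℝ :=
  2 * labelRate s α n + √(labelRate s α n) * (1 + labelRate s α n + Real.logb 2 α)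

theorem tendsto_guessingLoss (s α : ℕ) :
    Filter.Tendsto (fun n => guessingLoss s α n) Filter.atTop (nhds 0) := by
  have h := tendsto_labelRate s α
  have h1 := (h.const_mul 2).add
    (h.sqrt.mul ((h.const_add 1).add_const (Real.logb 2 α)))
  simpa [guessingLoss] using h1

/-! ### Guessing functions and the choice between the two bounds -/

/-- Bijectivity turns the sum into the harmonic number of α^n, which is at most 1 + n log α. -/
theorem sum_one_div_guess_le {X : Type*} [Fintype X] {n : ℕ} {G : (Fin n → X) → ℕ}
    (hG : IsGuessingFunction G) :
    ∑ x, 1 / (G x : ℝ) ≤ 1 + n * (Fintype.card X + 1) := by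
  classical
  have himg : Finset.univ.image G = Finset.Icc 1 (Fintype.card X ^ n) := by
    rw [← Finset.coe_inj]
    simpa using hG.image_eq
  have hinj : Set.InjOn G (Finset.univ : Finset (Fin n → X)) := by
    simpa using hG.injOn
  rw [← Finset.sum_image (f := fun k : ℕ => 1 / (k : ℝ)) hinj, himg]
  have h1 : ∑ k ∈ Finset.Icc 1 (Fintype.card X ^ n), 1 / (k : ℝ) =
      ((harmonic (Fintype.card X ^ n) : ℚ) : ℝ) := by
    rw [harmonic_eq_sum_Icc]; push_cast; simp
  rw [h1]
  refine (harmonic_le_one_add_log _).trans ?_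
  push_cast
  rw [Real.log_pow]
  gcongr
  exact (Real.log_le_self (Nat.cast_nonneg _)).trans (by linarith)

theorem two_rpow_mul_logb_self (c : ℕ) (ρ : ℝ) :
    (2 : ℝ) ^ (ρ * ((c : ℝ) * Real.logb 2 c)) = ((c : ℝ) ^ c) ^ ρ := by
  rcases Nat.eq_zero_or_pos c with rfl | hc
  -- For c = 0 both sides are 1, as `logb 2 0 = 0` and `0 ^ 0 = 1`.
  · simp
  · have hc' : (0 : ℝ) < c := by exact_mod_cast hc
    rw [mul_comm ρ, Real.rpow_mul two_pos.le, mul_comm (c : ℝ), Real.rpow_mul two_pos.le,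
      Real.rpow_logb two_pos (by norm_num) hc', Real.rpow_natCast]

namespace FiniteStateSource

variable {X Z : Type*} [Fintype X] [DecidableEq X] [Fintype Z] [DecidableEq Z]
  (P : FiniteStateSource X Z)

theorem sum_listProb_mul_le {n : ℕ} (g : List X → ℝ) (hg : ∀ v ∈ listWords X n, 0 < g v)
    (hH : ∑ v ∈ listWords X n, 1 / g v ≤ 1 + n * (Fintype.card X + 1)) {ρ : ℝ} (hρ : 0 < ρ) :
    ∑ w ∈ listWords X n,
        P.listProb w * (((lzParse w).length : ℝ) ^ (lzParse w).length) ^ ρ ≤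
      2 ^ (ρ * n * guessingLoss (Fintype.card Z) (Fintype.card X) n) *
        ∑ v ∈ listWords X n, P.listProb v * g v ^ ρ := by
  have hX : 0 < Fintype.card X := by
    rcases Nat.eq_zero_or_pos (Fintype.card X) with h | h
    · have := Fintype.card_eq_zero_iff.1 h
      have h1 := P.prob_sum P.init
      simp at h1
    · exact h
  have hX' : (0 : ℝ) < Fintype.card X := by exact_mod_cast hX
  have hη := phraseRate_pos (Fintype.card X) n
  have hc := fun w (hw : w ∈ listWords X n) => length_lzParse_le_phraseRate_mul hw
  have hH0 : (1 : ℝ) ≤ 1 + n * (Fintype.card X + 1) := by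
    have : (0 : ℝ) ≤ n * (Fintype.card X + 1) := by positivity
    linarith
  have hK := two_rpow_labelRate (Fintype.card Z) (Fintype.card X) n
  have hv := labelRate_nonneg (Fintype.card Z) (Fintype.card X) n
  have hR0 : 0 ≤ ∑ v ∈ listWords X n, P.listProb v * g v ^ ρ := Finset.sum_nonneg fun v hv =>
    mul_nonneg (P.listProb_nonneg v) (Real.rpow_nonneg (hg v hv).le _)
  have ha : 0 ≤ Real.logb 2 (Fintype.card X : ℝ) :=
    Real.logb_nonneg (by norm_num) (by exact_mod_cast hX)
  have hD1 := one_le_labelBound (Fintype.card Z) n hη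
  unfold guessingLoss
  have hI := P.sum_listProb_mul_le_of_rearrangement hη hc g hg (by linarith) hH hρ
  have hII := P.sum_listProb_mul_le_of_ziv hη hc g hg (by linarith) hH hρ
  set v := labelRate (Fintype.card Z) (Fintype.card X) n
  set D := labelBound (Fintype.card Z) n (phraseRate (Fintype.card X) n)
  set H : ℝ := 1 + n * (Fintype.card X + 1) with hHdef
  set a := Real.logb 2 (Fintype.card X : ℝ)
  have hsq : √v * √v = v := Real.mul_self_sqrt hv
  have hsq0 := Real.sqrt_nonneg v
  have hn0 : (0 : ℝ) ≤ n := Nat.cast_nonneg n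
  -- Divided by ρ n, the extra loss is v / ρ in the first bound and ρ (v + a) in the second. The
  -- threshold √v makes them at most √v and √v (v + a).
  rcases le_or_gt (√v) ρ with hρv | hρv
  · refine hI.trans (mul_le_mul_of_nonneg_right ?_ hR0)
    have h1 : (n + 1) * D ≤ (2 : ℝ) ^ (n * v) := by
      rw [hK, mul_comm]
      gcongr
      nlinarith
    calc (n + 1) * D * (D * H) ^ ρ ≤ 2 ^ (n * v) * (2 ^ (n * v)) ^ ρ := by
          rw [← hK]; gcongr
      _ = 2 ^ (n * v + n * v * ρ) := by
          rw [Real.rpow_add two_pos, Real.rpow_mul two_pos.le (n * v)]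
      _ ≤ _ := by
          refine Real.rpow_le_rpow_of_exponent_le (by norm_num) ?_
          have h2 : v ≤ ρ * √v := by nlinarith
          have h3 : 0 ≤ ρ * (v + √v * (v + a)) := by positivity
          have h4 : v + v * ρ ≤ ρ * (2 * v + √v * (1 + v + a)) := by nlinarith
          calc _ = n * (v + v * ρ) := by ring
            _ ≤ n * (ρ * (2 * v + √v * (1 + v + a))) := by gcongr
            _ = _ := by ring
  · refine hII.trans (mul_le_mul_of_nonneg_right ?_ hR0)
    have hD0 : 0 < D := by linarith
    have hDK : D ≤ (2 : ℝ) ^ (n * v) := by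
      rw [hK]; exact le_mul_of_one_le_right hD0.le hH0
    have hXa : (Fintype.card X : ℝ) ^ n = 2 ^ (n * a) := by
      rw [mul_comm, Real.rpow_mul two_pos.le, Real.rpow_logb two_pos (by norm_num) hX',
        Real.rpow_natCast]
    calc (D ^ 2 * H * (D * (Fintype.card X : ℝ) ^ n) ^ ρ) ^ ρ
        = (D * (D * H) * (D * (Fintype.card X : ℝ) ^ n) ^ ρ) ^ ρ := by rw [sq, mul_assoc D]
      _ ≤ (2 ^ (n * v) * 2 ^ (n * v) * (2 ^ (n * v) * 2 ^ (n * a)) ^ ρ) ^ ρ := by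
          rw [← hK, hXa]; gcongr
      _ = 2 ^ ((n * v + n * v + (n * v + n * a) * ρ) * ρ) := by
          rw [← Real.rpow_add two_pos, ← Real.rpow_add two_pos, ← Real.rpow_mul two_pos.le,
            ← Real.rpow_add two_pos, ← Real.rpow_mul two_pos.le]
      _ ≤ _ := by
          refine Real.rpow_le_rpow_of_exponent_le (by norm_num) ?_
          have h2 : ρ * (v + a) ≤ √v * (v + a) := by gcongr
          calc _ = ρ * n * (2 * v + ρ * (v + a)) := by ring
            _ ≤ _ := by
              gcongr
              nlinarith

end FiniteStateSource

theorem theorem2 :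
    ∃ Δ : ℕ → ℕ → ℕ → ℝ,
      (∀ s α : ℕ, Filter.Tendsto (fun n => Δ s α n) Filter.atTop (nhds 0)) ∧
      ∀ (X Z : Type*) [Fintype X] [DecidableEq X] [Fintype Z]
        (P : FiniteStateSource X Z) (n : ℕ) (G : (Fin n → X) → ℕ),
        IsGuessingFunction G →
        ∀ ρ : ℝ, 0 < ρ →
          P.expect (fun x => (G x : ℝ) ^ ρ) ≥
            (2 : ℝ) ^ (-(ρ * n * Δ (Fintype.card Z) (Fintype.card X) n)) *
              P.expect (fun x : Fin n → X =>
                (2 : ℝ) ^ (ρ * ((lzCount x : ℝ) * Real.logb 2 (lzCount x : ℝ)))) := by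
  refine ⟨guessingLoss, tendsto_guessingLoss, ?_⟩
  intro X Z _ _ _ P n G hG ρ hρ
  classical
  -- The value 1 on lists of other lengths plays no role: only words of length n enter the sums.
  set g : List X → ℝ :=
    Function.extend (fun x : Fin n → X => List.ofFn x) (fun x => (G x : ℝ)) 1 with hgdef
  have hgx : ∀ x : Fin n → X, g (List.ofFn x) = G x := fun x =>
    (List.ofFn_injective (n := n)).extend_apply _ _ x
  have hg : ∀ v ∈ listWords X n, 0 < g v := by
    intro v hv
    obtain ⟨x, -, rfl⟩ := Finset.mem_map.1 hv
    have h1 : 1 ≤ G x := (hG.mapsTo (Set.mem_univ x)).1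
    rw [Function.Embedding.coeFn_mk, hgx]
    exact_mod_cast h1
  have hH : ∑ v ∈ listWords X n, 1 / g v ≤ 1 + n * (Fintype.card X + 1) := by
    rw [sum_listWords]
    simpa only [hgx] using sum_one_div_guess_le hG
  have h := P.sum_listProb_mul_le g hg hH hρ
  rw [sum_listWords, sum_listWords] at h
  simp only [hgx, ← P.wordProb_eq_listProb] at h
  simp only [FiniteStateSource.expect, two_rpow_mul_logb_self, lzCount]
  rw [ge_iff_le, Real.rpow_neg two_pos.le, inv_mul_le_iff₀ (by positivity)]
  exact h
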